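/- Let $(t,x,w_0,w_1,w_2,\dots)$ with $w_0=w$, $w_1=w_x$, $w_2=w_{xx}$, … be the coordinates on the manifold defined by the potential Burgers equation $w_t=w_{xx}+w_x^2$ in the infinite-order jet space over $\mathbb R^2_{t,x}\times\mathbb R_w$. A (reduced) differential function is a smooth real-valued function of finitely many of these coordinates. On differential functions put $$\mathrm D_x=\partial_x+\sum_{k\ge0}w_{k+1}\partial_{w_k},\qquad \mathrm D_t=\partial_t+\sum_{k\ge0}\big(\mathrm D_x^kL\big)\partial_{w_k},\qquad L:=w_2+w_1^2 .$$ A generalized vector field $\eta\,\partial_w$, whose characteristic $\eta$ is a differential function, has the prolongation $\sum_{k\ge0}(\mathrm D_x^k\eta)\partial_{w_k}$, and the Lie bracket of two such fields is the commutator of their prolongations. Such a field is a generalized symmetry of the potential Burgers equation (in evolution form with reduced characteristic) if $$\mathrm D_t\eta=\sum_{k\ge0}\frac{\partial L}{\partial w_k}\,\mathrm D_x^k\eta=\mathrm D_x^2\eta+2w_x\mathrm D_x\eta .$$ **Theorem.** The generalized symmetries of $w_t=w_{xx}+w_x^2$ form a Lie algebra $\Sigma_2$, and it is the semidirect sum $\Sigma_2=\Lambda_2\ltimes\Sigma_2^{-\infty}$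 (that is, $\Lambda_2$ is a Lie subalgebra, $\Sigma_2^{-\infty}$ is an ideal of $\Sigma_2$, and $\Sigma_2=\Lambda_2\oplus\Sigma_2^{-\infty}$ as a vector space). Here $\Lambda_2$ is the real linear span of the fields $$\tilde{\mathfrak Q}^{kl}=(\tilde{\mathrm G}^k\tilde{\mathrm P}^l1)\,\partial_w,\quad k,l\in\mathbb N_0,\qquad \tilde{\mathrm P}=\mathrm D_x+w_x,\quad \tilde{\mathrm G}=t\tilde{\mathrm P}+\tfrac12x,$$ and $\Sigma_2^{-\infty}$ consists of the fields $\tilde{\mathfrak Z}(h)=h(t,x)e^{-w}\,\partial_w$, where $h$ runs through the smooth solutions on $\mathbb R^2$ of the heat equation $h_t=h_{xx}$. -/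

import Mathlib

open scoped ContDiff

noncomputable section

namespace PotBurgers

/-- The coordinates `t, x, w_0 = w, w_1 = w_x, w_2 = w_xx, …` on the manifold defined by an
evolution equation in the infinite-order jet space over `ℝ²_{t,x} × ℝ_w`. -/
inductive Coord : Type
  | t : Coord
  | x : Coord
  | w (k : ℕ) : Coord
  deriving DecidableEq

/-- Points of that manifold, given by the values of all coordinates. -/
abbrev Jet : Type := Coord → ℝ

/-- A (reduced) differential function: a smooth function of finitely many of the coordinates. -/
def IsDiffFun (F : Jet → ℝ) : Prop :=
  ∃ (s : Finset Coord) (f : (s → ℝ) → ℝ), ContDiff ℝ ∞ f ∧ ∀ p : Jet, F p = f (fun i => p i)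

theorem IsDiffFun.enlarge {F : Jet → ℝ} {s : Finset Coord} {f : (s → ℝ) → ℝ}
    (hf : ContDiff ℝ ∞ f) (hF : ∀ p : Jet, F p = f (fun i => p i)) {s' : Finset Coord}
    (hs : s ⊆ s') :
    ∃ f' : (s' → ℝ) → ℝ, ContDiff ℝ ∞ f' ∧ ∀ p : Jet, F p = f' (fun i => p i) := by
  refine ⟨fun y => f (fun i => y ⟨i.1, hs i.2⟩), ?_, fun p => hF p⟩
  exact hf.comp (contDiff_pi.2 fun i => contDiff_apply ℝ ℝ _)

theorem IsDiffFun.map₂ {F G : Jet → ℝ} (hF : IsDiffFun F) (hG : IsDiffFun G) {op : ℝ → ℝ → ℝ}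
    (hop : ContDiff ℝ ∞ (fun z : ℝ × ℝ => op z.1 z.2)) :
    IsDiffFun (fun p => op (F p) (G p)) := by
  obtain ⟨s, f, hf, hFf⟩ := hF
  obtain ⟨s', g, hg, hGg⟩ := hG
  obtain ⟨f', hf', hFf'⟩ := IsDiffFun.enlarge hf hFf (Finset.subset_union_left (s₂ := s'))
  obtain ⟨g', hg', hGg'⟩ := IsDiffFun.enlarge hg hGg (Finset.subset_union_right (s₁ := s))
  refine ⟨s ∪ s', fun y => op (f' y) (g' y), ?_, fun p =>
    congrArg₂ op (hFf' p) (hGg' p)⟩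
  exact hop.comp (hf'.prodMk hg')

theorem IsDiffFun.const (c : ℝ) : IsDiffFun (fun _ => c) :=
  ⟨∅, fun _ => c, contDiff_const, fun _ => rfl⟩

theorem IsDiffFun.coord (i : Coord) : IsDiffFun (fun p => p i) :=
  ⟨{i}, fun y => y ⟨i, Finset.mem_singleton_self i⟩, contDiff_apply ℝ ℝ _, fun _ => rfl⟩

/-- The commutative algebra of differential functions, with pointwise operations. -/
def diffAlg : Subalgebra ℝ (Jet → ℝ) where
  carrier := {F | IsDiffFun F}
  mul_mem' hF hG := IsDiffFun.map₂ hF hG (op := (· * ·)) (contDiff_fst.mul contDiff_snd)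
  add_mem' hF hG := IsDiffFun.map₂ hF hG (op := (· + ·)) (contDiff_fst.add contDiff_snd)
  algebraMap_mem' c := IsDiffFun.const c

/-- Differential functions. -/
abbrev DiffFun : Type := diffAlg

/-- A coordinate as a differential function. -/
def coord (i : Coord) : DiffFun := ⟨fun p => p i, IsDiffFun.coord i⟩

/-- The partial derivative of a function on the jet manifold with respect to a coordinate. -/
def pderiv (i : Coord) (F : Jet → ℝ) : Jet → ℝ :=
  fun p => deriv (fun r => F (Function.update p i r)) (p i)

theorem hasDerivAt_of_mem {F : Jet → ℝ} {s : Finset Coord} {f : (s → ℝ) → ℝ}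
    (hf : ContDiff ℝ ∞ f) (hF : ∀ p : Jet, F p = f (fun i => p i)) {i : Coord} (hi : i ∈ s)
    (p : Jet) :
    HasDerivAt (fun r => F (Function.update p i r))
      (fderiv ℝ f (fun j => p j) (Pi.single ⟨i, hi⟩ 1)) (p i) := by
  have h1 : (fun r => F (Function.update p i r)) =
      f ∘ (fun r => Function.update (fun j : s => p j) ⟨i, hi⟩ r) := by
    funext r
    rw [hF, Function.comp]
    congr 1
    funext j
    by_cases hj : j = ⟨i, hi⟩
    · subst hj; simp
    · have : (j : Coord) ≠ i := fun h => hj (Subtype.ext h)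
      simp [Function.update_of_ne, hj, this]
  rw [h1]
  have h2 := hasDerivAt_update (fun j : s => p j) ⟨i, hi⟩ (p i)
  have h3 : Function.update (fun j : s => p j) ⟨i, hi⟩ (p i) = fun j : s => p j :=
    Function.update_eq_self (⟨i, hi⟩ : s) (fun j : s => p j)
  refine HasFDerivAt.comp_hasDerivAt (p i) ?_ h2
  rw [h3]
  exact ((hf.differentiable (by simp)) _).hasFDerivAt

theorem pderiv_of_notMem {F : Jet → ℝ} {s : Finset Coord} {f : (s → ℝ) → ℝ}
    (hF : ∀ p : Jet, F p = f (fun i => p i)) {i : Coord} (hi : i ∉ s) : pderiv i F = 0 := by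
  funext p
  have h1 : (fun r => F (Function.update p i r)) = fun _ => F p := by
    funext r
    rw [hF, hF]
    congr 1
    funext j
    refine Function.update_of_ne (fun h => hi ?_) _ _
    rw [← h]
    exact j.2
  simp [pderiv, h1]

theorem IsDiffFun.differentiableAt {F : Jet → ℝ} (hF : IsDiffFun F) (i : Coord) (p : Jet) :
    DifferentiableAt ℝ (fun r => F (Function.update p i r)) (p i) := by
  obtain ⟨s, f, hf, hFf⟩ := hF
  obtain ⟨f', hf', hFf'⟩ := IsDiffFun.enlarge hf hFf (Finset.subset_insert i s)
  exact (hasDerivAt_of_mem hf' hFf' (Finset.mem_insert_self i s) p).differentiableAt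

theorem IsDiffFun.pderiv {F : Jet → ℝ} (hF : IsDiffFun F) (i : Coord) :
    IsDiffFun (pderiv i F) := by
  obtain ⟨s, f, hf, hFf⟩ := hF
  obtain ⟨f', hf', hFf'⟩ := IsDiffFun.enlarge hf hFf (Finset.subset_insert i s)
  refine ⟨insert i s, fun y => fderiv ℝ f' y (Pi.single ⟨i, Finset.mem_insert_self i s⟩ 1), ?_,
    fun p => (hasDerivAt_of_mem hf' hFf' (Finset.mem_insert_self i s) p).deriv⟩
  exact (hf'.fderiv_right (m := ∞) (by simp)).clm_apply contDiff_const

/-- The partial derivative `∂/∂i` as a derivation of the algebra of differential functions. -/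
def partialD (i : Coord) : Derivation ℝ DiffFun DiffFun :=
  Derivation.mk'
    { toFun := fun F => ⟨pderiv i F.1, IsDiffFun.pderiv F.2 i⟩
      map_add' := fun F G => Subtype.ext <| funext fun p =>
        deriv_fun_add (IsDiffFun.differentiableAt F.2 i p) (IsDiffFun.differentiableAt G.2 i p)
      map_smul' := fun c F => Subtype.ext <| funext fun p =>
        deriv_fun_const_smul c (IsDiffFun.differentiableAt F.2 i p) }
    (fun F G => Subtype.ext <| funext fun p => by
      have h := deriv_fun_mul (IsDiffFun.differentiableAt F.2 i p)
        (IsDiffFun.differentiableAt G.2 i p)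
      rw [Function.update_eq_self] at h
      refine h.trans ?_
      change _ = F.1 p * pderiv i G.1 p + G.1 p * pderiv i F.1 p
      simp only [pderiv]
      ring)

theorem finite_support_partialD (F : DiffFun) :
    (Function.support fun i => partialD i F).Finite := by
  obtain ⟨s, f, hf, hFf⟩ := F.2
  refine s.finite_toSet.subset fun i hi => ?_
  by_contra his
  exact hi (Subtype.ext (pderiv_of_notMem hFf his))

theorem finite_support_coeff (c : Coord → DiffFun) (F : DiffFun) :
    (Function.support fun i => c i * partialD i F).Finite :=
  (finite_support_partialD F).subset fun i hi h => hi (by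
    change c i * partialD i F = 0
    rw [show partialD i F = 0 from h, mul_zero])

/-- The vector field `∑ c_i ∂/∂i` (sum over all coordinates), acting on differential functions;
each of these depends on finitely many coordinates, so that the sum is finite. -/
def vectorField (c : Coord → DiffFun) : Derivation ℝ DiffFun DiffFun :=
  Derivation.mk'
    { toFun := fun F => ∑ᶠ i, c i * partialD i F
      map_add' := fun F G => by
        simp only [map_add, mul_add]
        exact finsum_add_distrib (finite_support_coeff c F) (finite_support_coeff c G)
      map_smul' := fun a F => by
        have h : ∀ i, c i * partialD i (a • F) = a • (c i * partialD i F) := fun i => by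
          rw [Derivation.map_smul, mul_smul_comm]
        simp only [h, RingHom.id_apply]
        exact (smul_finsum' a (finite_support_coeff c F)).symm }
    (fun F G => by
      change ∑ᶠ i, c i * partialD i (F * G) =
        F * (∑ᶠ i, c i * partialD i G) + G * (∑ᶠ i, c i * partialD i F)
      rw [mul_finsum' _ _ (finite_support_coeff c G), mul_finsum' _ _ (finite_support_coeff c F),
        ← finsum_add_distrib]
      · refine finsum_congr fun i => ?_
        rw [Derivation.leibniz, smul_eq_mul, smul_eq_mul]
        ring
      · exact (finite_support_coeff c G).subset fun i hi h => hi (by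
          change F * (c i * partialD i G) = 0
          rw [show c i * partialD i G = 0 from h, mul_zero])
      · exact (finite_support_coeff c F).subset fun i hi h => hi (by
          change G * (c i * partialD i F) = 0
          rw [show c i * partialD i F = 0 from h, mul_zero]))

theorem vectorField_apply (c : Coord → DiffFun) (F : DiffFun) :
    vectorField c F = ∑ᶠ i, c i * partialD i F := rfl

/-- The total derivative `D_x = ∂_x + ∑ w_{k+1} ∂_{w_k}`. -/
def Dx : Derivation ℝ DiffFun DiffFun :=
  vectorField fun
    | .t => 0
    | .x => 1
    | .w k => coord (.w (k + 1))

/-- The right-hand side `L[w] = w_xx + w_x²` of the potential Burgers equation. -/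
def burgersRHS : DiffFun := coord (.w 2) + coord (.w 1) ^ 2

/-- The total derivative with respect to `t`, restricted to the potential Burgers equation:
`D_t = ∂_t + ∑ (D_x^k L[w]) ∂_{w_k}`. -/
def Dt : Derivation ℝ DiffFun DiffFun :=
  vectorField fun
    | .t => 1
    | .x => 0
    | .w k => Dx^[k] burgersRHS

/-- The generalized vector field `η ∂_w` in evolution form with the characteristic `η`, in its
prolonged form `∑ (D_x^k η) ∂_{w_k}`. It determines `η`, as its value at the coordinate `w`.
The commutator of generalized vector fields is the commutator of their prolongations, that is,
the Lie bracket of derivations. The assignment is linear in `η`. -/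
def evol : DiffFun →ₗ[ℝ] Derivation ℝ DiffFun DiffFun where
  toFun η := vectorField fun
    | .t => 0
    | .x => 0
    | .w k => Dx^[k] η
  map_add' η θ := by
    ext1 F
    rw [Derivation.add_apply, vectorField_apply, vectorField_apply, vectorField_apply,
      ← finsum_add_distrib (finite_support_coeff _ F) (finite_support_coeff _ F)]
    refine finsum_congr fun i => ?_
    cases i with
    | t => simp
    | x => simp
    | w k => simp [iterate_map_add, add_mul]
  map_smul' a η := by
    ext1 F
    rw [RingHom.id_apply, Derivation.smul_apply, vectorField_apply, vectorField_apply,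
      smul_finsum' a (finite_support_coeff _ F)]
    refine finsum_congr fun i => ?_
    cases i with
    | t => simp
    | x => simp
    | w k =>
      have h : Dx^[k] (a • η) = a • Dx^[k] η := by
        induction k with
        | zero => rfl
        | succ k ih => rw [Function.iterate_succ_apply', ih, Derivation.map_smul, Function.iterate_succ_apply']
      simp [h]

/-- The (reduced) characteristics of generalized symmetries of `w_t = w_xx + w_x²`: the
generalized vector field `η ∂_w` satisfies the invariance condition, that is, its prolongation
annihilates `w_t - L[w]` on the manifold of the equation. -/
def symChars : Submodule ℝ DiffFun where
  carrier := {η | Dt η = evol η burgersRHS}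
  add_mem' {η θ} hη hθ := by
    change Dt (η + θ) = evol (η + θ) burgersRHS
    rw [map_add, map_add, Derivation.add_apply, show Dt η = _ from hη, show Dt θ = _ from hθ]
  zero_mem' := by
    change Dt 0 = evol 0 burgersRHS
    rw [map_zero, map_zero, Derivation.zero_apply]
  smul_mem' a η hη := by
    change Dt (a • η) = evol (a • η) burgersRHS
    rw [Derivation.map_smul, map_smul, Derivation.smul_apply, show Dt η = _ from hη]

/-- The space `Σ₂` of generalized symmetries of the potential Burgers equation (generalized
vector fields in evolution form with reduced characteristics). -/
def genSym : Submodule ℝ (Derivation ℝ DiffFun DiffFun) := symChars.map evol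

/-- The operator `P̃ = D_x + w_x`. -/
def opP : Module.End ℝ DiffFun := (Dx : DiffFun →ₗ[ℝ] DiffFun) + LinearMap.mulLeft ℝ (coord (.w 1))

/-- The operator `G̃ = t P̃ + x / 2`. -/
def opG : Module.End ℝ DiffFun :=
  LinearMap.mulLeft ℝ (coord .t) ∘ₗ opP + LinearMap.mulLeft ℝ ((1 / 2 : ℝ) • coord .x)

/-- The generalized vector field `Q̃^{kl} = (G̃^k P̃^l 1) ∂_w`. -/
def Q (k l : ℕ) : Derivation ℝ DiffFun DiffFun := evol ((opG ^ k) ((opP ^ l) 1))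

/-- The space `Λ₂` spanned by all `Q̃^{kl}`. -/
def essSym : Submodule ℝ (Derivation ℝ DiffFun DiffFun) :=
  Submodule.span ℝ {R | ∃ k l : ℕ, R = Q k l}

/-- `h` is a (smooth) solution of the heat equation `h_t = h_xx`. -/
def IsHeatSol (h : ℝ → ℝ → ℝ) : Prop :=
  ContDiff ℝ ∞ (fun z : ℝ × ℝ => h z.1 z.2) ∧
    ∀ t x : ℝ, deriv (fun r => h r x) t = deriv (deriv (fun y => h t y)) x

/-- The differential function `h(t,x) e^{-w}`. -/
def zChar (h : ℝ → ℝ → ℝ) (hh : ContDiff ℝ ∞ (fun z : ℝ × ℝ => h z.1 z.2)) : DiffFun :=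
  ⟨fun p => h (p .t) (p .x) * Real.exp (-p (.w 0)),
    IsDiffFun.map₂ (op := fun a b => a * Real.exp (-b))
      (IsDiffFun.map₂ (IsDiffFun.coord .t) (IsDiffFun.coord .x) hh) (IsDiffFun.coord (.w 0))
      (contDiff_fst.mul (Real.contDiff_exp.comp contDiff_snd.neg))⟩

theorem IsHeatSol.add {h g : ℝ → ℝ → ℝ} (hh : IsHeatSol h) (hg : IsHeatSol g) :
    IsHeatSol (h + g) := by
  have key : ∀ {h : ℝ → ℝ → ℝ}, IsHeatSol h →
      (∀ t, ContDiff ℝ ∞ (h t)) ∧ ∀ x, ContDiff ℝ ∞ (fun r => h r x) := fun hh =>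
    ⟨fun t => hh.1.comp (contDiff_const.prodMk contDiff_id),
      fun x => hh.1.comp (contDiff_id.prodMk contDiff_const)⟩
  refine ⟨hh.1.add hg.1, fun t x => ?_⟩
  have d1 : ∀ {f : ℝ → ℝ}, ContDiff ℝ ∞ f → Differentiable ℝ f := fun hf =>
    hf.differentiable (by simp)
  have d2 : ∀ {f : ℝ → ℝ}, ContDiff ℝ ∞ f → Differentiable ℝ (deriv f) := fun hf =>
    (contDiff_infty_iff_deriv.1 hf).2.differentiable (by simp)
  have e : deriv (fun y => (h + g) t y) = fun y => deriv (h t) y + deriv (g t) y :=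
    funext fun y => deriv_fun_add (d1 ((key hh).1 t) y) (d1 ((key hg).1 t) y)
  rw [e, deriv_fun_add (d2 ((key hh).1 t) x) (d2 ((key hg).1 t) x)]
  refine (deriv_fun_add (d1 ((key hh).2 x) t) (d1 ((key hg).2 x) t)).trans ?_
  rw [hh.2 t x, hg.2 t x]

theorem IsHeatSol.smul (a : ℝ) {h : ℝ → ℝ → ℝ} (hh : IsHeatSol h) : IsHeatSol (a • h) := by
  refine ⟨contDiff_const.mul hh.1, fun t x => ?_⟩
  have e : deriv (fun y => (a • h) t y) = fun y => a * deriv (h t) y :=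
    funext fun y => deriv_const_mul_field a
  rw [e, deriv_const_mul_field]
  refine (deriv_const_mul_field a).trans ?_
  rw [hh.2 t x]

/-- The space `Σ₂^{-∞}` of the generalized vector fields `Z̃(h) = h(t,x) e^{-w} ∂_w`, where `h`
runs through the solutions of the heat equation. -/
def trivSym : Submodule ℝ (Derivation ℝ DiffFun DiffFun) where
  carrier := {R | ∃ (h : ℝ → ℝ → ℝ) (hh : IsHeatSol h), R = evol (zChar h hh.1)}
  add_mem' := by
    rintro _ _ ⟨h, hh, rfl⟩ ⟨g, hg, rfl⟩
    refine ⟨h + g, hh.add hg, ?_⟩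
    rw [← map_add]
    exact congrArg evol (Subtype.ext (funext fun p => (add_mul _ _ _).symm))
  zero_mem' := by
    refine ⟨fun _ _ => 0, ⟨contDiff_const, fun t x => by simp⟩, ?_⟩
    rw [← map_zero evol]
    exact congrArg evol (Subtype.ext (funext fun p => (zero_mul _).symm))
  smul_mem' := by
    rintro a _ ⟨h, hh, rfl⟩
    refine ⟨a • h, hh.smul a, ?_⟩
    rw [← map_smul]
    exact congrArg evol (Subtype.ext (funext fun p => (mul_assoc _ _ _).symm))

/-- `S` is a Lie subalgebra of `L` and the semidirect sum of its subalgebra `A` and its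
ideal `I`. -/
structure IsSemidirectSum {L : Type*} [LieRing L] [LieAlgebra ℝ L] (S A I : Submodule ℝ L) :
    Prop where
  /-- `S` is a Lie subalgebra -/
  lie_mem : ∀ X ∈ S, ∀ Y ∈ S, ⁅X, Y⁆ ∈ S
  /-- `A` is a Lie subalgebra -/
  lie_mem_sub : ∀ X ∈ A, ∀ Y ∈ A, ⁅X, Y⁆ ∈ A
  /-- `I` is an ideal of `S` -/
  lie_mem_ideal : ∀ X ∈ S, ∀ Y ∈ I, ⁅X, Y⁆ ∈ I
  /-- `S = A + I` -/
  sup_eq : A ⊔ I = S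
  /-- the sum is direct -/
  disjoint : Disjoint A I

end PotBurgers

end

/-!
The substitution `u = e^w` linearizes the potential Burgers equation to the heat equation
`u_t = u_xx`. A field `η ∂_w` corresponds to `ζ ∂_u` with `ζ = e^w η` (`evolU`), and it is a
symmetry iff `D_x² ζ = D_t ζ` (`mem_symChars_iff`). Under this correspondence `P̃` becomes `D_x`,
`G̃` becomes `K = t D_x + x/2` (`opK`), and `h e^{-w}` becomes `h`. Hence the three spaces of the
theorem are the images of `ker (D_x² - D_t)`, of `linChars`, the span of all `K^k D_x^l u`, and of
`heatFuns`, the space of solutions `h(t,x)` of the heat equation.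

The brackets are computed by `⁅ζ ∂_u, ξ ∂_u⁆ = (ζ ∂_u (ξ) - ξ ∂_u (ζ)) ∂_u`. The prolongation of a
symmetry commutes with `D_x`, `D_t` and functions of `t, x`; therefore it preserves
`ker (D_x² - D_t)`, and it maps `A u` to `A ζ` for an operator `A` in `D_x` and `K`. As
`[D_x, K] = 1/2`, both `linChars` and `heatFuns` are stable under such operators. The two spaces
are independent since `∂_w = ∑ u_k ∂/∂u_k` is the identity on the first and zero on the second.

The main point is that they span all symmetries (`ker_heatOp_eq`). It rests on the derivations
`∂/∂u_k` in the coordinates `t, x, u_k = D_x^k u`, which satisfy `[∂/∂u_k, D_x] = ∂/∂u_{k-1}` and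
`[∂/∂u_k, D_x² - D_t] = 2 D_x ∂/∂u_{k-1}`. For a symmetry `ζ` of order `n` and `a = ∂ζ/∂u_n` the
second relation, for `k = n + 1` and `k = n`, gives `D_x a = 0` and
`D_t a = 2 D_x (∂ζ/∂u_{n-1})`. Consequently `a` depends on `t` only, and
`a_t = 2 ∂ζ_x/∂u_{n-1}`, where `ζ_x` is a symmetry of order at most `n - 1`. By induction `a` is a
polynomial in `t` of degree at most `n` (`partialU_mem_polyT`). Since `∂/∂u_n` of
`K^k D_x^(n-k) u` is `t^k`, a combination of these functions can be subtracted from `ζ` to lower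
its order, until only a function of `t` and `x` remains. No assumption of linearity in `u` is
needed.
-/

noncomputable section

namespace PotBurgers

/-! ### Partial derivatives and vector fields -/

theorem partialD_val (i : Coord) (F : DiffFun) (p : Jet) :
    (partialD i F).1 p = deriv (fun r => F.1 (Function.update p i r)) (p i) := rfl

theorem partialD_coord (i j : Coord) : partialD i (coord j) = if i = j then 1 else 0 := by
  refine Subtype.ext (funext fun p => ?_)
  rw [partialD_val]
  split_ifs with h
  · subst h
    simp [coord]
  · simp [coord, Function.update_of_ne (Ne.symm h)]

theorem partialD_comm (i j : Coord) (F : DiffFun) :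
    partialD i (partialD j F) = partialD j (partialD i F) := by
  obtain ⟨s, f, hf, hF⟩ := F.2
  obtain ⟨s', hs, hi, hj⟩ : ∃ s' : Finset Coord, s ⊆ s' ∧ i ∈ s' ∧ j ∈ s' :=
    ⟨insert j (insert i s), (Finset.subset_insert i s).trans (Finset.subset_insert j _),
      by simp, by simp⟩
  obtain ⟨g, hg, hG⟩ := IsDiffFun.enlarge hf hF hs
  have first : ∀ {k : Coord} (hk : k ∈ s') (p : Jet),
      (partialD k F).1 p = fderiv ℝ g (fun l => p l) (Pi.single ⟨k, hk⟩ 1) :=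
    fun hk p => (hasDerivAt_of_mem hg hG hk p).deriv
  have hg' : ContDiff ℝ ∞ (fderiv ℝ g) := hg.fderiv_right (m := ∞) (by simp)
  have second : ∀ {k l : Coord} (hk : k ∈ s') (hl : l ∈ s') (p : Jet),
      (partialD l (partialD k F)).1 p =
        fderiv ℝ (fderiv ℝ g) (fun l => p l) (Pi.single ⟨l, hl⟩ 1) (Pi.single ⟨k, hk⟩ 1) := by
    intro k l hk hl p
    refine (hasDerivAt_of_mem (f := fun y => fderiv ℝ g y (Pi.single ⟨k, hk⟩ 1))
      (hg'.clm_apply contDiff_const) (first hk) hl p).deriv.trans ?_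
    rw [fderiv_clm_apply (hg'.differentiable (by simp) _) (differentiableAt_const _)]
    simp
  refine Subtype.ext (funext fun p => ?_)
  rw [second hj hi, second hi hj]
  exact (hg.contDiffAt.isSymmSndFDerivAt (by simpa using ENat.LEInfty.out)).eq _ _

theorem exists_finset_partialD_eq_zero (F : DiffFun) :
    ∃ s : Finset Coord, ∀ i ∉ s, partialD i F = 0 := by
  refine ⟨(finite_support_partialD F).toFinset, fun i hi => ?_⟩
  simpa using hi

theorem vectorField_eq_sum (c : Coord → DiffFun) {F : DiffFun} {s : Finset Coord}
    (hs : ∀ i ∉ s, partialD i F = 0) : vectorField c F = ∑ i ∈ s, c i * partialD i F := by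
  rw [vectorField_apply]
  refine finsum_eq_sum_of_support_subset _ fun i hi => ?_
  by_contra h
  exact hi (by simp [hs i h])

@[simp]
theorem vectorField_coord (c : Coord → DiffFun) (i : Coord) : vectorField c (coord i) = c i := by
  rw [vectorField_eq_sum (s := {i}) c fun j hj => by
    rw [partialD_coord, if_neg (by simpa using hj)]]
  simp [partialD_coord]

theorem lie_vectorField (c d : Coord → DiffFun) :
    ⁅vectorField c, vectorField d⁆ =
      vectorField fun i => vectorField c (d i) - vectorField d (c i) := by
  ext1 F
  obtain ⟨s, hs⟩ := exists_finset_partialD_eq_zero F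
  have hs' : ∀ j, ∀ i ∉ s, partialD i (partialD j F) = 0 := fun j i hi => by
    rw [partialD_comm, hs i hi, map_zero]
  rw [Derivation.commutator_apply, vectorField_eq_sum _ hs, vectorField_eq_sum _ hs,
    vectorField_eq_sum _ hs, map_sum, map_sum]
  simp only [Derivation.leibniz, smul_eq_mul, Finset.sum_add_distrib, sub_mul,
    Finset.sum_sub_distrib]
  have hcomm : ∑ i ∈ s, d i * vectorField c (partialD i F) =
      ∑ i ∈ s, c i * vectorField d (partialD i F) := by
    simp only [vectorField_eq_sum _ (hs' _), Finset.mul_sum]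
    rw [Finset.sum_comm]
    refine Finset.sum_congr rfl fun i _ => Finset.sum_congr rfl fun j _ => ?_
    rw [partialD_comm j i]
    ring
  rw [hcomm]
  simp only [mul_comm (partialD _ F)]
  ring

/-- The Lie algebra of those derivations of the algebra of differential functions that have the
form `∑ c_i ∂/∂i`. -/
def vectorFields : LieSubalgebra ℝ (Derivation ℝ DiffFun DiffFun) where
  carrier := {X | ∃ c, X = vectorField c}
  add_mem' := by
    rintro _ _ ⟨c, rfl⟩ ⟨d, rfl⟩
    refine ⟨c + d, ?_⟩
    ext1 F
    obtain ⟨s, hs⟩ := exists_finset_partialD_eq_zero F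
    simp [vectorField_eq_sum _ hs, add_mul, Finset.sum_add_distrib]
  zero_mem' := by
    refine ⟨0, ?_⟩
    ext1 F
    simp [vectorField_apply]
  smul_mem' := by
    rintro a _ ⟨c, rfl⟩
    refine ⟨a • c, ?_⟩
    ext1 F
    obtain ⟨s, hs⟩ := exists_finset_partialD_eq_zero F
    simp [vectorField_eq_sum _ hs, Finset.smul_sum]
  lie_mem' := by
    rintro _ _ ⟨c, rfl⟩ ⟨d, rfl⟩
    exact ⟨_, lie_vectorField c d⟩

theorem vectorField_mem (c : Coord → DiffFun) : vectorField c ∈ vectorFields := ⟨c, rfl⟩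

theorem eq_vectorField {X : Derivation ℝ DiffFun DiffFun} (hX : X ∈ vectorFields) :
    X = vectorField fun i => X (coord i) := by
  obtain ⟨c, rfl⟩ := hX
  simp

theorem vectorFields_ext {X Y : Derivation ℝ DiffFun DiffFun} (hX : X ∈ vectorFields)
    (hY : Y ∈ vectorFields) (h : ∀ i, X (coord i) = Y (coord i)) : X = Y := by
  rw [eq_vectorField hX, eq_vectorField hY]
  simp [h]

theorem partialD_eq_vectorField (i : Coord) : partialD i = vectorField (Pi.single i 1) := by
  ext1 F
  obtain ⟨s, hs⟩ := exists_finset_partialD_eq_zero F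
  rw [vectorField_eq_sum (s := insert i s) _ fun j hj => hs j (by simp_all)]
  rw [Finset.sum_eq_single i]
  · simp
  · intro j _ hj
    simp [hj]
  · simp

theorem partialD_mem (i : Coord) : partialD i ∈ vectorFields :=
  partialD_eq_vectorField i ▸ vectorField_mem _

theorem Dx_mem : Dx ∈ vectorFields := vectorField_mem _

theorem Dt_mem : Dt ∈ vectorFields := vectorField_mem _

theorem evol_mem (η : DiffFun) : evol η ∈ vectorFields := vectorField_mem _

/-- A vector field `X` satisfies `X ∘ D_x = D_x ∘ X + Y` if this holds on the coordinates. -/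
theorem apply_Dx_of_coord {X Y : Derivation ℝ DiffFun DiffFun} (hX : X ∈ vectorFields)
    (hY : Y ∈ vectorFields) (h : ∀ i, X (Dx (coord i)) = Dx (X (coord i)) + Y (coord i))
    (F : DiffFun) : X (Dx F) = Dx (X F) + Y F := by
  have := vectorFields_ext (vectorFields.lie_mem hX Dx_mem) hY fun i => by
    rw [Derivation.commutator_apply, h i]; abel
  have := DFunLike.congr_fun this F
  rw [Derivation.commutator_apply] at this
  rw [← this]; abel

/-- A vector field `X` commutes with a vector field `Y` if it does so on the coordinates. -/
theorem apply_comm_of_coord {X Y : Derivation ℝ DiffFun DiffFun} (hX : X ∈ vectorFields)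
    (hY : Y ∈ vectorFields) (h : ∀ i, X (Y (coord i)) = Y (X (coord i))) (F : DiffFun) :
    X (Y F) = Y (X F) := by
  have := vectorFields_ext (vectorFields.lie_mem hX hY) vectorFields.zero_mem fun i => by
    rw [Derivation.commutator_apply, h i, sub_self, Derivation.zero_apply]
  have := DFunLike.congr_fun this F
  rwa [Derivation.commutator_apply, Derivation.zero_apply, sub_eq_zero] at this

@[simp] theorem Dx_t : Dx (coord .t) = 0 := vectorField_coord _ _
@[simp] theorem Dx_x : Dx (coord .x) = 1 := vectorField_coord _ _
@[simp] theorem Dx_w (k : ℕ) : Dx (coord (.w k)) = coord (.w (k + 1)) := vectorField_coord _ _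
@[simp] theorem Dt_t : Dt (coord .t) = 1 := vectorField_coord _ _
@[simp] theorem Dt_x : Dt (coord .x) = 0 := vectorField_coord _ _
@[simp] theorem Dt_w (k : ℕ) : Dt (coord (.w k)) = Dx^[k] burgersRHS := vectorField_coord _ _
@[simp] theorem evol_t (η : DiffFun) : evol η (coord .t) = 0 := vectorField_coord _ _
@[simp] theorem evol_x (η : DiffFun) : evol η (coord .x) = 0 := vectorField_coord _ _
@[simp] theorem evol_w (η : DiffFun) (k : ℕ) : evol η (coord (.w k)) = Dx^[k] η :=
  vectorField_coord _ _

/-- Differential functions whose derivatives vanish in all directions outside `T` depend only on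
the coordinates in `T`. -/
theorem eq_of_partialD_eq_zero {F : DiffFun} {T : Set Coord} (hF : ∀ i ∉ T, partialD i F = 0)
    {p q : Jet} (hpq : ∀ i ∈ T, p i = q i) : F.1 p = F.1 q := by
  classical
  obtain ⟨s, f, -, hf⟩ := F.2
  -- The values of `q` are replaced by those of `p` one coordinate of `s` at a time.
  have key : ∀ r : Finset Coord, F.1 (fun i => if i ∈ r then p i else q i) = F.1 q := by
    intro r
    induction r using Finset.induction_on with
    | empty => simp
    | insert i r hi ih =>
      rw [← ih]
      have hup : (fun j => if j ∈ insert i r then p j else q j) =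
          Function.update (fun j => if j ∈ r then p j else q j) i (p i) := by
        funext j
        by_cases hj : j = i
        · subst hj; simp
        · simp [hj]
      have hself : (fun j => if j ∈ r then p j else q j) =
          Function.update (fun j => if j ∈ r then p j else q j) i (q i) := by
        funext j
        by_cases hj : j = i
        · subst hj; simp [hi]
        · simp [hj]
      rw [hup]
      nth_rw 2 [hself]
      by_cases hT : i ∈ T
      · rw [hpq i hT]
      · set p' : Jet := fun j => if j ∈ r then p j else q j
        refine is_const_of_deriv_eq_zero (f := fun a => F.1 (Function.update p' i a))
          (fun a => ?_) (fun a => ?_) _ _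
        · simpa using IsDiffFun.differentiableAt F.2 i (Function.update p' i a)
        · have := congrFun (congrArg Subtype.val (hF i hT)) (Function.update p' i a)
          rw [partialD_val] at this
          simpa using this
  rw [← key s, hf, hf]
  congr 1
  funext i
  simp

/-! ### Commutation with the total derivatives -/

theorem iterate_Dx_comm {X : Derivation ℝ DiffFun DiffFun} (h : ∀ F, X (Dx F) = Dx (X F))
    (k : ℕ) (F : DiffFun) : X (Dx^[k] F) = Dx^[k] (X F) := by
  induction k with
  | zero => rfl
  | succ k ih => rw [Function.iterate_succ_apply', Function.iterate_succ_apply', h, ih]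

theorem evol_Dx (η F : DiffFun) : evol η (Dx F) = Dx (evol η F) := by
  refine apply_comm_of_coord (evol_mem η) Dx_mem (fun i => ?_) F
  cases i with
  | t => simp
  | x => simp
  | w k => simp only [Dx_w, evol_w, Function.iterate_succ_apply']

theorem Dt_Dx (F : DiffFun) : Dt (Dx F) = Dx (Dt F) := by
  refine apply_comm_of_coord Dt_mem Dx_mem (fun i => ?_) F
  cases i with
  | t => simp
  | x => simp
  | w k => simp only [Dx_w, Dt_w, Function.iterate_succ_apply']

theorem partialD_x_Dx (F : DiffFun) : partialD .x (Dx F) = Dx (partialD .x F) := by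
  refine apply_comm_of_coord (partialD_mem _) Dx_mem (fun i => ?_) F
  cases i <;> simp [partialD_coord]

theorem partialD_w_zero_Dx (F : DiffFun) :
    partialD (.w 0) (Dx F) = Dx (partialD (.w 0) F) := by
  refine apply_comm_of_coord (partialD_mem _) Dx_mem (fun i => ?_) F
  cases i with
  | t => simp [partialD_coord]
  | x => simp [partialD_coord]
  | w k => cases k <;> simp [partialD_coord]

theorem partialD_w_succ_Dx (k : ℕ) (F : DiffFun) :
    partialD (.w (k + 1)) (Dx F) = Dx (partialD (.w (k + 1)) F) + partialD (.w k) F := by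
  refine apply_Dx_of_coord (partialD_mem _) (partialD_mem _) (fun i => ?_) F
  cases i with
  | t => simp [partialD_coord]
  | x => simp [partialD_coord]
  | w j =>
    simp only [Dx_w, partialD_coord, Coord.w.injEq, Nat.add_right_cancel_iff]
    split_ifs <;> simp

theorem partialD_x_burgersRHS : partialD .x burgersRHS = 0 := by
  simp [burgersRHS, partialD_coord, pow_two]

theorem partialD_x_Dt (F : DiffFun) : partialD .x (Dt F) = Dt (partialD .x F) := by
  refine apply_comm_of_coord (partialD_mem _) Dt_mem (fun i => ?_) F
  cases i with
  | t => simp [partialD_coord]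
  | x => simp [partialD_coord]
  | w k =>
    rw [Dt_w, iterate_Dx_comm partialD_x_Dx, partialD_x_burgersRHS, iterate_map_zero]
    simp [partialD_coord]

theorem evol_Dt {η : DiffFun} (hη : η ∈ symChars) (F : DiffFun) :
    evol η (Dt F) = Dt (evol η F) := by
  refine apply_comm_of_coord (evol_mem η) Dt_mem (fun i => ?_) F
  cases i with
  | t => simp
  | x => simp
  | w k =>
    rw [Dt_w, evol_w, iterate_Dx_comm (evol_Dx η), iterate_Dx_comm Dt_Dx]
    exact congrArg _ (Eq.symm hη)

theorem lie_evol (η θ : DiffFun) : ⁅evol η, evol θ⁆ = evol (evol η θ - evol θ η) := by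
  refine vectorFields_ext (vectorFields.lie_mem (evol_mem η) (evol_mem θ)) (evol_mem _)
    fun i => ?_
  rw [Derivation.commutator_apply]
  cases i with
  | t => simp
  | x => simp
  | w k => simp only [evol_w, iterate_Dx_comm (evol_Dx _), iterate_map_sub]

/-! ### Linearization of the equation by `u = e^w` -/

/-- The differential function `u = e^w`; the substitution turns the potential Burgers equation
into the heat equation `u_t = u_xx`. -/
def expW : DiffFun :=
  ⟨fun p => Real.exp (p (.w 0)), IsDiffFun.map₂ (op := fun a _ => Real.exp a)
    (IsDiffFun.coord (.w 0)) (IsDiffFun.coord (.w 0)) (Real.contDiff_exp.comp contDiff_fst)⟩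

/-- The differential function `e^{-w}`. -/
def expNegW : DiffFun :=
  ⟨fun p => Real.exp (-p (.w 0)), IsDiffFun.map₂ (op := fun a _ => Real.exp (-a))
    (IsDiffFun.coord (.w 0)) (IsDiffFun.coord (.w 0)) (Real.contDiff_exp.comp contDiff_fst.neg)⟩

theorem expW_mul_expNegW : expW * expNegW = 1 := by
  refine Subtype.ext (funext fun p => ?_)
  change Real.exp (p (.w 0)) * Real.exp (-p (.w 0)) = 1
  rw [← Real.exp_add, add_neg_cancel, Real.exp_zero]

theorem expW_mul_cancel (F : DiffFun) : expW * (expNegW * F) = F := by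
  rw [← mul_assoc, expW_mul_expNegW, one_mul]

theorem expNegW_mul_cancel (F : DiffFun) : expNegW * (expW * F) = F := by
  rw [← mul_assoc, mul_comm expNegW, expW_mul_expNegW, one_mul]

theorem expW_mul_eq_zero {F : DiffFun} : expW * F = 0 ↔ F = 0 :=
  ⟨fun h => by rw [← expNegW_mul_cancel F, h, mul_zero], fun h => by rw [h, mul_zero]⟩

theorem partialD_expW (i : Coord) : partialD i expW = if i = .w 0 then expW else 0 := by
  refine Subtype.ext (funext fun p => ?_)
  rw [partialD_val]
  split_ifs with h
  · subst h
    simp [expW]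
  · simp [expW, Function.update_of_ne (Ne.symm h)]

theorem apply_expW {X : Derivation ℝ DiffFun DiffFun} (hX : X ∈ vectorFields) :
    X expW = expW * X (coord (.w 0)) := by
  rw [eq_vectorField hX, vectorField_coord, vectorField_eq_sum (s := {.w 0}) _ fun i hi => by
    rw [partialD_expW, if_neg (by simpa using hi)], Finset.sum_singleton, partialD_expW,
    if_pos rfl, mul_comm]

theorem apply_expNegW {X : Derivation ℝ DiffFun DiffFun} (hX : X ∈ vectorFields) :
    X expNegW = -(expNegW * X (coord (.w 0))) := by
  have h := congrArg X expW_mul_expNegW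
  rw [Derivation.leibniz, Derivation.map_one_eq_zero, smul_eq_mul, smul_eq_mul,
    apply_expW hX] at h
  have h2 := congrArg (expNegW * ·) h
  simp only [mul_add, expNegW_mul_cancel, mul_zero] at h2
  rw [eq_neg_iff_add_eq_zero, ← h2]

@[simp] theorem Dx_expW : Dx expW = expW * coord (.w 1) := by
  rw [apply_expW Dx_mem, Dx_w]

/-- The generalized vector field whose prolongation maps `u = e^w` to the given function, that
is, the generalized vector field `ζ ∂_u` in the coordinates `u_k = D_x^k u`. -/
def evolU : DiffFun →ₗ[ℝ] Derivation ℝ DiffFun DiffFun := evol ∘ₗ LinearMap.mulLeft ℝ expNegW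

theorem evolU_apply (ζ : DiffFun) : evolU ζ = evol (expNegW * ζ) := rfl

theorem evolU_expW_mul (η : DiffFun) : evolU (expW * η) = evol η := by
  rw [evolU_apply, expNegW_mul_cancel]

theorem evolU_expW (ζ : DiffFun) : evolU ζ expW = ζ := by
  rw [evolU_apply, apply_expW (evol_mem _), evol_w]
  exact expW_mul_cancel ζ

theorem evolU_Dx (ζ F : DiffFun) : evolU ζ (Dx F) = Dx (evolU ζ F) := evol_Dx _ F

theorem lie_evolU (ζ ξ : DiffFun) : ⁅evolU ζ, evolU ξ⁆ = evolU (evolU ζ ξ - evolU ξ ζ) := by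
  have h : ⁅evolU ζ, evolU ξ⁆ = evol _ := lie_evol _ _
  have h2 := DFunLike.congr_fun h expW
  rw [Derivation.commutator_apply, evolU_expW, evolU_expW, ← evolU_expW_mul, evolU_expW] at h2
  rw [h2, evolU_expW_mul, h]

/-- The operator `D_x² - D_t` of the heat equation. -/
def heatOp : Module.End ℝ DiffFun :=
  (Dx : DiffFun →ₗ[ℝ] DiffFun) ∘ₗ (Dx : DiffFun →ₗ[ℝ] DiffFun) - (Dt : DiffFun →ₗ[ℝ] DiffFun)

theorem heatOp_apply (F : DiffFun) : heatOp F = Dx (Dx F) - Dt F := rfl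

theorem evol_burgersRHS (η : DiffFun) :
    evol η burgersRHS = Dx (Dx η) + 2 * coord (.w 1) * Dx η := by
  simp only [burgersRHS, map_add, pow_two, Derivation.leibniz, evol_w, smul_eq_mul,
    Function.iterate_succ_apply', Function.iterate_zero_apply]
  ring

theorem heatOp_expW_mul (η : DiffFun) :
    heatOp (expW * η) = expW * (evol η burgersRHS - Dt η) := by
  have hDt : Dt expW = expW * burgersRHS := by
    rw [apply_expW Dt_mem, Dt_w, Function.iterate_zero_apply]
  simp only [heatOp_apply, evol_burgersRHS, Derivation.leibniz, smul_eq_mul, map_add, Dx_expW,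
    hDt, Dx_w]
  rw [burgersRHS]
  ring

theorem mem_symChars_iff {η : DiffFun} : η ∈ symChars ↔ heatOp (expW * η) = 0 := by
  rw [heatOp_expW_mul, expW_mul_eq_zero, sub_eq_zero]
  exact eq_comm

theorem evolU_heatOp {ζ : DiffFun} (hζ : heatOp ζ = 0) (F : DiffFun) :
    evolU ζ (heatOp F) = heatOp (evolU ζ F) := by
  have h : expNegW * ζ ∈ symChars := by rwa [mem_symChars_iff, expW_mul_cancel]
  rw [heatOp_apply, heatOp_apply, map_sub, evolU_Dx, evolU_Dx]
  exact congrArg _ (evol_Dt h F)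

theorem genSym_eq : genSym = (LinearMap.ker heatOp).map evolU := by
  ext X
  constructor
  · rintro ⟨η, hη, rfl⟩
    exact ⟨expW * η, mem_symChars_iff.1 hη, evolU_expW_mul η⟩
  · rintro ⟨ζ, hζ, rfl⟩
    refine ⟨expNegW * ζ, mem_symChars_iff.2 ?_, rfl⟩
    rwa [expW_mul_cancel]

/-! ### Linear characteristics -/

/-- The operator `t D_x + x / 2`, the conjugate of `G̃` by the multiplication by `e^w`. -/
def opK : Module.End ℝ DiffFun :=
  LinearMap.mulLeft ℝ (coord .t) ∘ₗ (Dx : DiffFun →ₗ[ℝ] DiffFun) +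
    LinearMap.mulLeft ℝ ((1 / 2 : ℝ) • coord .x)

theorem opK_apply (F : DiffFun) :
    opK F = coord .t * Dx F + ((1 / 2 : ℝ) • coord .x) * F := rfl

theorem Dx_opK (F : DiffFun) : Dx (opK F) = opK (Dx F) + (1 / 2 : ℝ) • F := by
  simp only [opK_apply, map_add, Derivation.leibniz, Derivation.map_smul, Dx_t, Dx_x, smul_eq_mul,
    smul_mul_assoc, mul_zero, add_zero, mul_one, smul_add]
  abel

theorem opK_commute_of_derivation {X : Derivation ℝ DiffFun DiffFun}
    (h : ∀ F, X (Dx F) = Dx (X F)) (ht : X (coord .t) = 0) (hx : X (coord .x) = 0)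
    (F : DiffFun) : X (opK F) = opK (X F) := by
  simp [opK_apply, Derivation.leibniz, h, ht, hx]

theorem heatOp_Dx (F : DiffFun) : heatOp (Dx F) = Dx (heatOp F) := by
  rw [heatOp_apply, heatOp_apply, Dt_Dx, map_sub]

theorem heatOp_opK (F : DiffFun) : heatOp (opK F) = opK (heatOp F) := by
  have hDt : Dt (opK F) = opK (Dt F) + Dx F := by
    simp only [opK_apply, map_add, Derivation.leibniz, Derivation.map_smul, Dt_t, Dt_x, Dt_Dx,
      smul_eq_mul, smul_zero, mul_zero, add_zero, mul_one]
    abel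
  have h2 : (1 / 2 : ℝ) • Dx F + (1 / 2 : ℝ) • Dx F = Dx F := by
    rw [← add_smul]; norm_num
  rw [heatOp_apply, heatOp_apply, hDt, Dx_opK, map_add, Dx_opK, Derivation.map_smul, map_sub,
    add_assoc, h2]
  abel

theorem heatOp_expW : heatOp expW = 0 := by
  have := heatOp_expW_mul 1
  rwa [mul_one, evol_burgersRHS, Derivation.map_one_eq_zero, map_zero, mul_zero, add_zero,
    Derivation.map_one_eq_zero, sub_zero, mul_zero] at this

/-- The span of the functions `(t D_x + x/2)^k D_x^l u`. -/
def linChars : Submodule ℝ DiffFun :=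
  Submodule.span ℝ {ζ | ∃ k l : ℕ, ζ = (opK ^ k) (Dx^[l] expW)}

theorem mem_linChars (k l : ℕ) : (opK ^ k) (Dx^[l] expW) ∈ linChars :=
  Submodule.subset_span ⟨k, l, rfl⟩

theorem opK_pow_succ (k : ℕ) (F : DiffFun) : (opK ^ (k + 1)) F = opK ((opK ^ k) F) := by
  rw [pow_succ', Module.End.mul_apply]

theorem opK_mem_linChars {ζ : DiffFun} (hζ : ζ ∈ linChars) : opK ζ ∈ linChars := by
  have : linChars ≤ linChars.comap opK := by
    refine Submodule.span_le.2 ?_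
    rintro _ ⟨k, l, rfl⟩
    change opK _ ∈ linChars
    rw [← opK_pow_succ]
    exact mem_linChars _ _
  exact this hζ

theorem Dx_mem_linChars {ζ : DiffFun} (hζ : ζ ∈ linChars) : Dx ζ ∈ linChars := by
  have : linChars ≤ linChars.comap (Dx : DiffFun →ₗ[ℝ] DiffFun) := by
    refine Submodule.span_le.2 ?_
    rintro _ ⟨k, l, rfl⟩
    change Dx _ ∈ linChars
    induction k with
    | zero =>
      have := mem_linChars 0 (l + 1)
      rwa [Function.iterate_succ_apply'] at this
    | succ k ih =>
      rw [opK_pow_succ, Dx_opK]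
      exact add_mem (opK_mem_linChars ih) (Submodule.smul_mem _ _ (mem_linChars _ _))
  exact this hζ

/-- A subspace that is stable under `D_x` and `t D_x + x/2` and contains `z` contains everything
that is obtained from `z` by a linear operator in the algebra generated by these two. -/
theorem opK_pow_iterate_mem {M : Submodule ℝ DiffFun} (hD : ∀ F ∈ M, Dx F ∈ M)
    (hK : ∀ F ∈ M, opK F ∈ M) {z : DiffFun} (hz : z ∈ M) (k l : ℕ) :
    (opK ^ k) (Dx^[l] z) ∈ M := by
  induction k with
  | zero =>
    rw [pow_zero, Module.End.one_apply]
    induction l with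
    | zero => exact hz
    | succ l ih => rw [Function.iterate_succ_apply']; exact hD _ ih
  | succ k ih => rw [opK_pow_succ]; exact hK _ ih

theorem derivation_opK_pow_iterate {X : Derivation ℝ DiffFun DiffFun}
    (h : ∀ F, X (Dx F) = Dx (X F)) (ht : X (coord .t) = 0) (hx : X (coord .x) = 0) (k l : ℕ)
    (F : DiffFun) : X ((opK ^ k) (Dx^[l] F)) = (opK ^ k) (Dx^[l] (X F)) := by
  induction k with
  | zero => exact iterate_Dx_comm h l F
  | succ k ih => rw [opK_pow_succ, opK_pow_succ, opK_commute_of_derivation h ht hx, ih]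

/-- If `ξ = A u` with a linear operator `A` in `D_x` and `t D_x + x/2`, then the field `ζ ∂_u`
maps `ξ` to `A ζ`. -/
theorem evolU_mem_of_mem_linChars {M : Submodule ℝ DiffFun} (hD : ∀ F ∈ M, Dx F ∈ M)
    (hK : ∀ F ∈ M, opK F ∈ M) {ζ ξ : DiffFun} (hζ : ζ ∈ M) (hξ : ξ ∈ linChars) :
    evolU ζ ξ ∈ M := by
  have : linChars ≤ M.comap (evolU ζ : DiffFun →ₗ[ℝ] DiffFun) := by
    refine Submodule.span_le.2 ?_
    rintro _ ⟨k, l, rfl⟩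
    change evolU ζ _ ∈ M
    rw [derivation_opK_pow_iterate (evolU_Dx ζ) (evol_t _) (evol_x _), evolU_expW]
    exact opK_pow_iterate_mem hD hK hζ k l
  exact this hξ

theorem linChars_le_ker_heatOp : linChars ≤ LinearMap.ker heatOp := by
  refine Submodule.span_le.2 ?_
  rintro _ ⟨k, l, rfl⟩
  refine opK_pow_iterate_mem (fun F hF => ?_) (fun F hF => ?_) heatOp_expW k l
  · rw [LinearMap.mem_ker] at hF ⊢
    rw [heatOp_Dx, hF, map_zero]
  · rw [LinearMap.mem_ker] at hF ⊢
    rw [heatOp_opK, hF, map_zero]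

theorem partialD_w_zero_of_mem_linChars {ζ : DiffFun} (hζ : ζ ∈ linChars) :
    partialD (.w 0) ζ = ζ := by
  induction hζ using Submodule.span_induction with
  | mem _ h =>
    obtain ⟨k, l, rfl⟩ := h
    rw [derivation_opK_pow_iterate partialD_w_zero_Dx (by simp [partialD_coord])
      (by simp [partialD_coord]), partialD_expW, if_pos rfl]
  | zero => exact map_zero _
  | add _ _ _ _ h₁ h₂ => rw [map_add, h₁, h₂]
  | smul a _ _ h => rw [Derivation.map_smul, h]

theorem expW_mul_opP (F : DiffFun) : expW * opP F = Dx (expW * F) := by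
  change expW * (Dx F + coord (.w 1) * F) = _
  rw [Derivation.leibniz, Dx_expW, smul_eq_mul, smul_eq_mul]
  ring

theorem expW_mul_opG (F : DiffFun) : expW * opG F = opK (expW * F) := by
  change expW * (coord .t * opP F + ((1 / 2 : ℝ) • coord .x) * F) = _
  rw [opK_apply, ← expW_mul_opP]
  ring

theorem Q_eq (k l : ℕ) : Q k l = evolU ((opK ^ k) (Dx^[l] expW)) := by
  rw [Q, ← evolU_expW_mul]
  congr 1
  induction k with
  | zero =>
    induction l with
    | zero => exact mul_one _
    | succ l ih =>
      simp only [pow_zero, Module.End.one_apply] at ih ⊢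
      rw [pow_succ', Module.End.mul_apply, expW_mul_opP, ih, Function.iterate_succ_apply']
  | succ k ih => rw [pow_succ', Module.End.mul_apply, expW_mul_opG, ih, opK_pow_succ]

theorem essSym_eq : essSym = linChars.map evolU := by
  rw [linChars, Submodule.map_span, essSym]
  congr 1
  ext R
  simp only [Set.mem_ofPred_eq, Set.mem_image, Q_eq]
  constructor
  · rintro ⟨k, l, rfl⟩
    exact ⟨_, ⟨k, l, rfl⟩, rfl⟩
  · rintro ⟨_, ⟨k, l, rfl⟩, rfl⟩
    exact ⟨k, l, rfl⟩

/-! ### Solutions of the heat equation as differential functions -/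

/-- The differential functions `h(t,x)`, where `h` solves the heat equation. -/
def heatFuns : Submodule ℝ DiffFun :=
  LinearMap.ker heatOp ⊓
    ⨅ k, LinearMap.ker (partialD (.w k) : DiffFun →ₗ[ℝ] DiffFun)

theorem mem_heatFuns {ζ : DiffFun} :
    ζ ∈ heatFuns ↔ heatOp ζ = 0 ∧ ∀ k, partialD (.w k) ζ = 0 := by
  simp [heatFuns]

theorem Dx_mem_heatFuns {ζ : DiffFun} (hζ : ζ ∈ heatFuns) : Dx ζ ∈ heatFuns := by
  rw [mem_heatFuns] at hζ ⊢
  refine ⟨by rw [heatOp_Dx, hζ.1, map_zero], fun k => ?_⟩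
  cases k with
  | zero => rw [partialD_w_zero_Dx, hζ.2, map_zero]
  | succ k => rw [partialD_w_succ_Dx, hζ.2, hζ.2, map_zero, add_zero]

theorem opK_mem_heatFuns {ζ : DiffFun} (hζ : ζ ∈ heatFuns) : opK ζ ∈ heatFuns := by
  have hD := mem_heatFuns.1 (Dx_mem_heatFuns hζ)
  rw [mem_heatFuns] at hζ ⊢
  refine ⟨by rw [heatOp_opK, hζ.1, map_zero], fun k => ?_⟩
  simp [opK_apply, Derivation.leibniz, hD.2, hζ.2, partialD_coord]

theorem vectorField_eq_of_partialD_w {F : DiffFun} (hF : ∀ k, partialD (.w k) F = 0)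
    (c : Coord → DiffFun) :
    vectorField c F = c .t * partialD .t F + c .x * partialD .x F := by
  rw [vectorField_eq_sum (s := {.t, .x}) c fun i hi => by
    cases i with
    | w k => exact hF k
    | t => simp at hi
    | x => simp at hi]
  exact Finset.sum_pair (by simp)

theorem Dx_eq_of_partialD_w {F : DiffFun} (hF : ∀ k, partialD (.w k) F = 0) :
    Dx F = partialD .x F := by
  rw [Dx, vectorField_eq_of_partialD_w hF, zero_mul, one_mul, zero_add]

theorem Dt_eq_of_partialD_w {F : DiffFun} (hF : ∀ k, partialD (.w k) F = 0) :
    Dt F = partialD .t F := by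
  rw [Dt, vectorField_eq_of_partialD_w hF, zero_mul, one_mul, add_zero]

theorem evol_eq_zero_of_partialD_w {F : DiffFun} (hF : ∀ k, partialD (.w k) F = 0)
    (η : DiffFun) : evol η F = 0 := by
  change vectorField _ F = 0
  rw [vectorField_eq_of_partialD_w hF, zero_mul, zero_mul, add_zero]

theorem evolU_eq_zero_of_mem_heatFuns {F : DiffFun} (hF : F ∈ heatFuns) (ζ : DiffFun) :
    evolU ζ F = 0 := evol_eq_zero_of_partialD_w (mem_heatFuns.1 hF).2 _

theorem heatOp_eq_of_partialD_w {F : DiffFun} (hF : ∀ k, partialD (.w k) F = 0) :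
    heatOp F = partialD .x (partialD .x F) - partialD .t F := by
  rw [heatOp_apply, Dt_eq_of_partialD_w hF, Dx_eq_of_partialD_w hF, Dx_eq_of_partialD_w]
  intro k
  rw [partialD_comm, hF, map_zero]

/-- The point of the jet manifold with given `t` and `x` at which all `w_k` vanish. -/
def zeroSection (t x : ℝ) : Jet
  | .t => t
  | .x => x
  | .w _ => 0

/-- The function of two variables `t, x` obtained by setting all `w_k` to zero. -/
def restrictTX (F : DiffFun) (t x : ℝ) : ℝ := F.1 (zeroSection t x)

theorem contDiff_restrictTX (F : DiffFun) :
    ContDiff ℝ ∞ (fun z : ℝ × ℝ => restrictTX F z.1 z.2) := by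
  obtain ⟨s, f, hf, hF⟩ := F.2
  have : (fun z : ℝ × ℝ => restrictTX F z.1 z.2) =
      f ∘ fun z : ℝ × ℝ => fun i : s => zeroSection z.1 z.2 i := funext fun z => hF _
  rw [this]
  refine hf.comp (contDiff_pi.2 ?_)
  rintro ⟨i, hi⟩
  cases i with
  | t => exact contDiff_fst
  | x => exact contDiff_snd
  | w k => exact contDiff_const

theorem deriv_restrictTX_t (F : DiffFun) (t x : ℝ) :
    deriv (fun r => restrictTX F r x) t = restrictTX (partialD .t F) t x := by
  have : (fun r => restrictTX F r x) =
      fun r => F.1 (Function.update (zeroSection t x) .t r) := funext fun r => by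
    refine congrArg F.1 (funext fun i => ?_)
    cases i <;> simp [zeroSection]
  rw [this]
  rfl

theorem deriv_restrictTX_x (F : DiffFun) (t x : ℝ) :
    deriv (fun y => restrictTX F t y) x = restrictTX (partialD .x F) t x := by
  have : (fun y => restrictTX F t y) =
      fun y => F.1 (Function.update (zeroSection t x) .x y) := funext fun y => by
    refine congrArg F.1 (funext fun i => ?_)
    cases i <;> simp [zeroSection]
  rw [this]
  rfl

theorem isHeatSol_restrictTX_iff {F : DiffFun} (hF : ∀ k, partialD (.w k) F = 0) :
    IsHeatSol (restrictTX F) ↔ heatOp F = 0 := by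
  have h2 : ∀ t x, deriv (deriv fun y => restrictTX F t y) x =
      restrictTX (partialD .x (partialD .x F)) t x := fun t x => by
    rw [funext (deriv_restrictTX_x F t), deriv_restrictTX_x]
  simp only [IsHeatSol, contDiff_restrictTX, true_and, h2, deriv_restrictTX_t,
    heatOp_eq_of_partialD_w hF, sub_eq_zero]
  refine ⟨fun h => ?_, fun h t x => by rw [h]⟩
  refine Subtype.ext (funext fun p => ?_)
  -- Both sides depend on `t` and `x` only.
  have hT : ∀ i ∉ ({.t, .x} : Set Coord), ∃ k, i = Coord.w k := by
    intro i hi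
    cases i with
    | t => simp at hi
    | x => simp at hi
    | w k => exact ⟨k, rfl⟩
  have hp : ∀ i ∈ ({.t, .x} : Set Coord), p i = zeroSection (p .t) (p .x) i := by
    rintro i (rfl | rfl) <;> rfl
  rw [eq_of_partialD_eq_zero (T := {.t, .x}) (fun i hi => ?_) hp,
    eq_of_partialD_eq_zero (T := {.t, .x}) (fun i hi => ?_) hp]
  · exact (h _ _).symm
  · obtain ⟨k, rfl⟩ := hT i hi
    rw [partialD_comm, hF, map_zero]
  · obtain ⟨k, rfl⟩ := hT i hi
    rw [partialD_comm, partialD_comm (.w k), hF, map_zero, map_zero]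

theorem expW_mul_zChar_val {h : ℝ → ℝ → ℝ} (hh : ContDiff ℝ ∞ (fun z : ℝ × ℝ => h z.1 z.2))
    (p : Jet) : (expW * zChar h hh).1 p = h (p .t) (p .x) := by
  change Real.exp (p (.w 0)) * (h (p .t) (p .x) * Real.exp (-p (.w 0))) = _
  rw [mul_left_comm, ← Real.exp_add, add_neg_cancel, Real.exp_zero, mul_one]

theorem partialD_w_expW_mul_zChar {h : ℝ → ℝ → ℝ}
    (hh : ContDiff ℝ ∞ (fun z : ℝ × ℝ => h z.1 z.2)) (k : ℕ) :
    partialD (.w k) (expW * zChar h hh) = 0 := by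
  refine Subtype.ext (funext fun p => ?_)
  rw [partialD_val]
  simp only [expW_mul_zChar_val]
  simp

theorem trivSym_eq : trivSym = heatFuns.map evolU := by
  ext X
  constructor
  · rintro ⟨h, hh, rfl⟩
    refine ⟨expW * zChar h hh.1, ?_, evolU_expW_mul _⟩
    have hw := partialD_w_expW_mul_zChar hh.1
    refine mem_heatFuns.2 ⟨(isHeatSol_restrictTX_iff hw).1 ?_, hw⟩
    have : restrictTX (expW * zChar h hh.1) = h := by
      funext t x
      exact expW_mul_zChar_val hh.1 _
    rwa [this]
  · rintro ⟨ζ, hζ, rfl⟩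
    obtain ⟨h0, hw⟩ := mem_heatFuns.1 hζ
    refine ⟨restrictTX ζ, (isHeatSol_restrictTX_iff hw).2 h0, ?_⟩
    rw [← evolU_expW_mul]
    congr 1
    refine Subtype.ext (funext fun p => ?_)
    rw [expW_mul_zChar_val]
    refine eq_of_partialD_eq_zero (T := {.t, .x}) (fun i hi => ?_) ?_
    · cases i with
      | t => simp at hi
      | x => simp at hi
      | w k => exact hw k
    · rintro i (rfl | rfl) <;> rfl

/-! ### Derivatives in the coordinates `u_k` -/

/-- The derivative `∂/∂u_k` in the coordinates `t, x, u_0, u_1, …` with `u_j = D_x^j e^w`, where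
the convention `∂/∂u_k = 0` for `k < 0` makes the commutation relations uniform. Since
`∂/∂u_k` and `D_x` satisfy the same commutation relations as `∂/∂w_k` and `D_x`, its value at
`w_j = D_x^j w` is `(j choose k) D_x^(j-k) e^{-w}`; for `j < k` the binomial coefficient
vanishes. -/
def partialU : ℤ → Derivation ℝ DiffFun DiffFun
  | .ofNat k => vectorField fun
    | .t => 0
    | .x => 0
    | .w j => j.choose k • Dx^[j - k] expNegW
  | .negSucc _ => 0

theorem partialU_of_neg {k : ℤ} (hk : k < 0) : partialU k = 0 := by
  obtain ⟨n, rfl⟩ := Int.eq_negSucc_of_lt_zero hk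
  rfl

theorem partialU_mem (k : ℤ) : partialU k ∈ vectorFields := by
  cases k with
  | ofNat k => exact vectorField_mem _
  | negSucc k => exact vectorFields.zero_mem

@[simp] theorem partialU_t (k : ℤ) : partialU k (coord .t) = 0 := by
  cases k with
  | ofNat k => exact vectorField_coord _ _
  | negSucc k => rfl

@[simp] theorem partialU_x (k : ℤ) : partialU k (coord .x) = 0 := by
  cases k with
  | ofNat k => exact vectorField_coord _ _
  | negSucc k => rfl

theorem partialU_natCast_w (k j : ℕ) :
    partialU k (coord (.w j)) = j.choose k • Dx^[j - k] expNegW := vectorField_coord _ _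

theorem partialU_w_zero (k : ℤ) :
    partialU k (coord (.w 0)) = if k = 0 then expNegW else 0 := by
  rcases lt_or_ge k 0 with hk | hk
  · rw [partialU_of_neg hk, if_neg hk.ne, Derivation.zero_apply]
  · lift k to ℕ using hk
    rw [partialU_natCast_w]
    cases k with
    | zero => simp
    | succ k => rw [if_neg (by omega), Nat.choose_zero_succ, zero_smul]

theorem partialU_Dx (k : ℤ) (F : DiffFun) :
    partialU k (Dx F) = Dx (partialU k F) + partialU (k - 1) F := by
  refine apply_Dx_of_coord (partialU_mem _) (partialU_mem _) (fun i => ?_) F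
  cases i with
  | t => simp
  | x => simp
  | w j =>
    rw [Dx_w]
    rcases lt_or_ge k 0 with hk | hk
    · simp [partialU_of_neg hk, partialU_of_neg (show k - 1 < 0 by omega)]
    lift k to ℕ using hk
    cases k with
    | zero =>
      rw [partialU_of_neg (show ((0 : ℕ) : ℤ) - 1 < 0 by omega), partialU_natCast_w,
        partialU_natCast_w, map_nsmul, ← Function.iterate_succ_apply' Dx]
      simp
    | succ k =>
      rw [show ((k + 1 : ℕ) : ℤ) - 1 = (k : ℕ) by push_cast; ring, partialU_natCast_w,
        partialU_natCast_w, partialU_natCast_w, map_nsmul, ← Function.iterate_succ_apply' Dx,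
        Nat.choose_succ_succ, add_smul, add_comm, Nat.add_sub_add_right]
      rcases Nat.lt_or_ge k j with h | h
      · rw [show (j - (k + 1)).succ = j - k by omega]
      · rw [Nat.choose_eq_zero_of_lt (show j < k + 1 by omega), zero_smul, zero_smul]

theorem Dx_expNegW : Dx expNegW = -(expNegW * coord (.w 1)) := by
  rw [apply_expNegW Dx_mem, Dx_w]

theorem Dt_expNegW : Dt expNegW = -(expNegW * burgersRHS) := by
  rw [apply_expNegW Dt_mem, Dt_w, Function.iterate_zero_apply]

theorem partialU_burgersRHS (k : ℤ) :
    partialU k burgersRHS = Dt (partialU k (coord (.w 0))) + partialU (k - 2) (coord (.w 0)) := by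
  have h1 : partialU k (coord (.w 1)) =
      Dx (partialU k (coord (.w 0))) + partialU (k - 1) (coord (.w 0)) := by
    rw [← partialU_Dx, Dx_w]
  have h2 : partialU k (coord (.w 2)) =
      Dx (Dx (partialU k (coord (.w 0)))) + 2 * Dx (partialU (k - 1) (coord (.w 0))) +
        partialU (k - 2) (coord (.w 0)) := by
    rw [show (coord (.w 2)) = Dx (Dx (coord (.w 0))) by simp, partialU_Dx, partialU_Dx,
      partialU_Dx, map_add, show k - 1 - 1 = k - 2 by ring]
    ring
  have hL : partialU k burgersRHS =
      partialU k (coord (.w 2)) + 2 * coord (.w 1) * partialU k (coord (.w 1)) := by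
    simp only [burgersRHS, map_add, pow_two, Derivation.leibniz, smul_eq_mul]
    ring
  rw [hL, h2, h1]
  simp only [partialU_w_zero]
  rcases eq_or_ne k 0 with rfl | h0
  · simp only [if_true, show (0 : ℤ) - 1 ≠ 0 by norm_num, show (0 : ℤ) - 2 ≠ 0 by norm_num,
      if_false, Dx_expNegW, Dt_expNegW, Derivation.map_neg, Derivation.leibniz, Dx_w, map_zero,
      smul_eq_mul]
    rw [burgersRHS]
    ring
  · rcases eq_or_ne k 1 with rfl | h1
    · simp only [sub_self, if_true, one_ne_zero, if_false, show (1 : ℤ) - 2 ≠ 0 by norm_num,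
        map_zero, Dx_expNegW]
      ring
    · simp only [h0, show k - 1 ≠ 0 by omega, if_false, map_zero]
      ring

theorem partialU_Dt (k : ℤ) (F : DiffFun) :
    partialU k (Dt F) = Dt (partialU k F) + partialU (k - 2) F := by
  have hw : ∀ (j : ℕ) (k : ℤ), partialU k (Dt (coord (.w j))) =
      Dt (partialU k (coord (.w j))) + partialU (k - 2) (coord (.w j)) := by
    intro j
    induction j with
    | zero => intro k; rw [Dt_w]; exact partialU_burgersRHS k
    | succ j ih =>
      intro k
      rw [← Dx_w, Dt_Dx, partialU_Dx, ih, ih, partialU_Dx, partialU_Dx, map_add, map_add, Dt_Dx,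
        show k - 1 - 2 = k - 2 - 1 by ring]
      abel
  have := vectorFields_ext (vectorFields.lie_mem (partialU_mem k) Dt_mem)
    (partialU_mem (k - 2)) fun i => by
      rw [Derivation.commutator_apply, sub_eq_iff_eq_add']
      cases i with
      | t => simp
      | x => simp
      | w j => exact hw j k
  have := DFunLike.congr_fun this F
  rwa [Derivation.commutator_apply, sub_eq_iff_eq_add'] at this

/-- The terms with `∂/∂u_{k-2}` cancel since `D_t u = D_x² u`. -/
theorem partialU_heatOp (k : ℤ) (F : DiffFun) :
    partialU k (heatOp F) = heatOp (partialU k F) + 2 * Dx (partialU (k - 1) F) := by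
  rw [heatOp_apply, heatOp_apply, map_sub, partialU_Dx, partialU_Dx, partialU_Dx, partialU_Dt,
    map_add, show k - 1 - 1 = k - 2 by ring]
  ring

theorem partialD_x_partialU (k : ℤ) (F : DiffFun) :
    partialD .x (partialU k F) = partialU k (partialD .x F) := by
  refine apply_comm_of_coord (partialD_mem _) (partialU_mem _) (fun i => ?_) F
  rcases lt_or_ge k 0 with hk | hk
  · simp [partialU_of_neg hk]
  lift k to ℕ using hk
  cases i with
  | t => simp [partialD_coord]
  | x => simp [partialD_coord]
  | w j =>
    have : partialD .x expNegW = 0 := by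
      rw [apply_expNegW (partialD_mem _)]
      simp [partialD_coord]
    rw [partialU_natCast_w, map_nsmul, iterate_Dx_comm partialD_x_Dx, this, iterate_map_zero]
    simp [partialD_coord]

theorem exists_order_bound (F : DiffFun) : ∃ N : ℕ, ∀ k ≥ N, partialD (.w k) F = 0 := by
  obtain ⟨s, hs⟩ := exists_finset_partialD_eq_zero F
  have hfin : {k : ℕ | Coord.w k ∈ s}.Finite :=
    s.finite_toSet.preimage (fun a _ b _ h => Coord.w.inj h)
  obtain ⟨N, hN⟩ := hfin.bddAbove
  exact ⟨N + 1, fun k hk => hs _ fun h => by have := hN h; omega⟩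

/-- In terms of the derivatives along `w_j`, the derivative along `u_k` involves only `j ≥ k`. -/
theorem partialU_eq_of_partialD_w_gt {F : DiffFun} {k : ℕ}
    (hF : ∀ j > k, partialD (.w j) F = 0) : partialU k F = expNegW * partialD (.w k) F := by
  rw [eq_vectorField (partialU_mem k), vectorField_apply, finsum_eq_single _ (Coord.w k)]
  · simp [partialU_natCast_w]
  · intro i hi
    cases i with
    | t => simp
    | x => simp
    | w j =>
      rcases lt_or_ge k j with h | h
      · rw [hF j h, mul_zero]
      · have hj : j < k := lt_of_le_of_ne h fun h => hi (by rw [h])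
        rw [partialU_natCast_w, Nat.choose_eq_zero_of_lt hj, zero_smul, zero_mul]

theorem exists_partialU_bound (F : DiffFun) : ∃ N : ℕ, ∀ k : ℤ, N ≤ k → partialU k F = 0 := by
  obtain ⟨N, hN⟩ := exists_order_bound F
  refine ⟨N, fun k hk => ?_⟩
  lift k to ℕ using by omega
  rw [partialU_eq_of_partialD_w_gt fun j hj => hN j (by omega), hN k (by omega), mul_zero]

theorem partialD_w_eq_zero_of_partialU {F : DiffFun} (hF : ∀ k : ℕ, partialU k F = 0) (k : ℕ) :
    partialD (.w k) F = 0 := by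
  obtain ⟨N, hN⟩ := exists_order_bound F
  have key : ∀ j k, N ≤ k + j → partialD (.w k) F = 0 := by
    intro j
    induction j with
    | zero => exact hN
    | succ j ih =>
      intro k hk
      have h := partialU_eq_of_partialD_w_gt (k := k) fun i hi => ih i (by omega)
      rw [hF] at h
      rw [← expW_mul_cancel (partialD _ F), ← h, mul_zero]
  exact key N k (by omega)

/-- If `D_x a` depends on `t` and `x` only, then so does `a`: the highest `u_m` in `a` would give
rise to `u_{m+1}` in `D_x a`. -/
theorem partialU_eq_zero_of_Dx {a : DiffFun} (h : ∀ k, partialU k (Dx a) = 0) (k : ℤ) :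
    partialU k a = 0 := by
  obtain ⟨N, hN⟩ := exists_partialU_bound a
  have key : ∀ (j : ℕ) (k : ℤ), (N : ℤ) ≤ k + j → partialU k a = 0 := by
    intro j
    induction j with
    | zero => intro k hk; exact hN k (by simpa using hk)
    | succ j ih =>
      intro k hk
      have h1 := partialU_Dx (k + 1) a
      rw [h, ih (k + 1) (by push_cast at hk; omega), map_zero, zero_add, add_sub_cancel_right]
        at h1
      exact h1.symm
  rcases lt_or_ge k 0 with hk | hk
  · rw [partialU_of_neg hk, Derivation.zero_apply]
  · exact key N k (by omega)

/-! ### The symbol of a symmetry -/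

/-- The polynomials in `t` of degree at most `n`. -/
def polyT (n : ℕ) : Submodule ℝ DiffFun :=
  Submodule.span ℝ {q | ∃ k ≤ n, q = coord .t ^ k}

theorem partialD_polyT {n : ℕ} {q : DiffFun} (hq : q ∈ polyT n) {i : Coord} (hi : i ≠ .t) :
    partialD i q = 0 := by
  have : polyT n ≤ LinearMap.ker (partialD i : DiffFun →ₗ[ℝ] DiffFun) := by
    refine Submodule.span_le.2 ?_
    rintro _ ⟨k, -, rfl⟩
    change partialD i _ = 0
    rw [Derivation.leibniz_pow, partialD_coord, if_neg hi, smul_zero, smul_zero]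
  exact this hq

theorem exists_antiderivative_polyT {n : ℕ} {q : DiffFun} (hq : q ∈ polyT n) :
    ∃ r ∈ polyT (n + 1), partialD .t r = q := by
  have : polyT n ≤ (polyT (n + 1)).map (partialD .t : DiffFun →ₗ[ℝ] DiffFun) := by
    refine Submodule.span_le.2 ?_
    rintro _ ⟨k, hk, rfl⟩
    refine ⟨((k + 1 : ℕ) : ℝ)⁻¹ • coord .t ^ (k + 1),
      Submodule.smul_mem _ _ (Submodule.subset_span ⟨k + 1, by omega, rfl⟩), ?_⟩
    change partialD .t _ = _
    rw [Derivation.map_smul, Derivation.leibniz_pow, partialD_coord, if_pos rfl, smul_eq_mul,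
      mul_one, Nat.add_sub_cancel, ← Nat.cast_smul_eq_nsmul ℝ, smul_smul, inv_mul_cancel₀,
      one_smul]
    positivity
  exact this hq

theorem mem_polyT_of_partialD_eq_zero {n : ℕ} {F : DiffFun} (hF : ∀ i, partialD i F = 0) :
    F ∈ polyT n := by
  have : F = F.1 0 • coord .t ^ 0 := by
    refine Subtype.ext (funext fun p => ?_)
    rw [pow_zero]
    change F.1 p = F.1 0 * 1
    rw [mul_one]
    exact eq_of_partialD_eq_zero (T := ∅) (fun i _ => hF i) (by simp)
  rw [this]
  exact Submodule.smul_mem _ _ (Submodule.subset_span ⟨0, by omega, rfl⟩)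

/-- The coefficient `a` of the highest derivative in a symmetry `ζ` of order `n` of the heat
equation depends on `t` only, and `a_t` is twice the coefficient of order `n - 1` in `ζ_x`. -/
theorem partialD_partialU_of_heatOp {n : ℤ} {ζ : DiffFun} (hζ : heatOp ζ = 0)
    (hn : ∀ m : ℤ, n < m → partialU m ζ = 0) :
    (∀ i, i ≠ .t → partialD i (partialU n ζ) = 0) ∧
      partialD .t (partialU n ζ) = 2 * partialU (n - 1) (partialD .x ζ) := by
  set a := partialU n ζ with ha
  have two_mul_cancel : ∀ F : DiffFun, 2 * F = 0 → F = 0 := fun F h => by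
    rw [two_mul, ← two_smul ℝ, smul_eq_zero] at h
    simpa using h
  have hDa : Dx a = 0 := by
    have h := partialU_heatOp (n + 1) ζ
    rw [hζ, map_zero, hn (n + 1) (by omega), map_zero, zero_add, add_sub_cancel_right] at h
    exact two_mul_cancel _ h.symm
  have hUa : ∀ k, partialU k a = 0 := partialU_eq_zero_of_Dx fun k => by rw [hDa, map_zero]
  have hwa : ∀ k, partialD (.w k) a = 0 := partialD_w_eq_zero_of_partialU fun k => hUa k
  have hxa : partialD .x a = 0 := by rw [← Dx_eq_of_partialD_w hwa, hDa]
  have hc : Dt a = 2 * Dx (partialU (n - 1) ζ) := by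
    have h := partialU_heatOp n ζ
    rw [hζ, map_zero, heatOp_apply, ← ha, hDa, map_zero, zero_sub] at h
    linear_combination h
  have hUc : ∀ k, partialU k (partialU (n - 1) ζ) = 0 := partialU_eq_zero_of_Dx fun k => by
    have h := congrArg (partialU k) hc
    rw [partialU_Dt, hUa, hUa, map_zero, add_zero, two_mul, map_add, ← two_mul] at h
    exact two_mul_cancel _ h.symm
  have hwc := partialD_w_eq_zero_of_partialU fun k => hUc k
  refine ⟨fun i hi => ?_, ?_⟩
  · cases i with
    | t => exact absurd rfl hi
    | x => exact hxa
    | w k => exact hwa k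
  · rw [← Dt_eq_of_partialD_w hwa, hc, Dx_eq_of_partialD_w hwc, partialD_x_partialU]

theorem heatOp_partialD_x {ζ : DiffFun} (hζ : heatOp ζ = 0) : heatOp (partialD .x ζ) = 0 := by
  rw [heatOp_apply, ← partialD_x_Dx, ← partialD_x_Dx, ← partialD_x_Dt, ← map_sub, ← heatOp_apply,
    hζ, map_zero]

/-- The coefficient of the highest derivative in a symmetry of order `n` of the heat equation
is a polynomial in `t` of degree at most `n`. -/
theorem partialU_mem_polyT (n : ℕ) {ζ : DiffFun} (hζ : heatOp ζ = 0)
    (hn : ∀ m : ℤ, n < m → partialU m ζ = 0) : partialU n ζ ∈ polyT n := by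
  induction n generalizing ζ with
  | zero =>
    obtain ⟨h1, h2⟩ := partialD_partialU_of_heatOp hζ hn
    refine mem_polyT_of_partialD_eq_zero fun i => ?_
    by_cases hi : i = .t
    · rw [hi, h2, partialU_of_neg (by simp), Derivation.zero_apply, mul_zero]
    · exact h1 i hi
  | succ n ih =>
    obtain ⟨h1, h2⟩ := partialD_partialU_of_heatOp hζ hn
    have hx : partialU n (partialD .x ζ) ∈ polyT n := by
      refine ih (heatOp_partialD_x hζ) fun m hm => ?_
      rw [← partialD_x_partialU]
      rcases eq_or_ne m (n + 1 : ℕ) with rfl | hne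
      · exact h1 _ (by simp)
      · rw [hn m (by push_cast at hne ⊢; omega), map_zero]
    rw [show ((n + 1 : ℕ) : ℤ) - 1 = n by push_cast; ring] at h2
    obtain ⟨r, hr, hrt⟩ := exists_antiderivative_polyT hx
    have hr2 : (2 : ℝ) • r ∈ polyT (n + 1) := Submodule.smul_mem _ _ hr
    rw [← sub_add_cancel (partialU (n + 1 : ℕ) ζ) ((2 : ℝ) • r)]
    refine add_mem (mem_polyT_of_partialD_eq_zero fun i => ?_) hr2
    rw [map_sub]
    by_cases hi : i = .t
    · rw [hi, h2, Derivation.map_smul, hrt, two_smul, two_mul, sub_self]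
    · rw [h1 i hi, partialD_polyT hr2 hi, sub_zero]

/-! ### Exhaustion of the symmetries -/

/-- `F` has order at most `n` in the coordinates `u_k`, and `q` is its derivative along `u_n`. -/
def HasSymbol (n : ℤ) (q F : DiffFun) : Prop :=
  (∀ m, n < m → partialU m F = 0) ∧ partialU n F = q

theorem HasSymbol.dx {n : ℤ} {q F : DiffFun} (h : HasSymbol n q F) :
    HasSymbol (n + 1) q (Dx F) := by
  refine ⟨fun m hm => ?_, ?_⟩
  · rw [partialU_Dx, h.1 m (by omega), h.1 (m - 1) (by omega), map_zero, add_zero]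
  · rw [partialU_Dx, h.1 (n + 1) (by omega), map_zero, zero_add, add_sub_cancel_right, h.2]

theorem partialU_opK (k : ℤ) (F : DiffFun) :
    partialU k (opK F) = opK (partialU k F) + coord .t * partialU (k - 1) F := by
  simp only [opK_apply, map_add, Derivation.leibniz, Derivation.map_smul, partialU_t, partialU_x,
    partialU_Dx, smul_eq_mul, smul_zero, mul_zero, add_zero]
  ring

theorem HasSymbol.opK {n : ℤ} {q F : DiffFun} (h : HasSymbol n q F) :
    HasSymbol (n + 1) (coord .t * q) (opK F) := by
  refine ⟨fun m hm => ?_, ?_⟩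
  · rw [partialU_opK, h.1 m (by omega), h.1 (m - 1) (by omega), map_zero, mul_zero, add_zero]
  · rw [partialU_opK, h.1 (n + 1) (by omega), map_zero, zero_add, add_sub_cancel_right, h.2]

theorem hasSymbol_expW : HasSymbol 0 1 expW := by
  refine ⟨fun m hm => ?_, ?_⟩
  · rw [apply_expW (partialU_mem m), partialU_w_zero, if_neg hm.ne', mul_zero]
  · rw [apply_expW (partialU_mem 0), partialU_w_zero, if_pos rfl, expW_mul_expNegW]

theorem hasSymbol_opK_pow_iterate (k l : ℕ) :
    HasSymbol (k + l) (coord .t ^ k) ((opK ^ k) (Dx^[l] expW)) := by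
  induction k with
  | zero =>
    induction l with
    | zero => simpa using hasSymbol_expW
    | succ l ih =>
      have := ih.dx
      simp only [pow_zero, Module.End.one_apply] at this ⊢
      rw [Function.iterate_succ_apply']
      convert this using 1
      push_cast; ring
  | succ k ih =>
    rw [opK_pow_succ, pow_succ']
    convert ih.opK using 1
    push_cast; ring

theorem exists_hasSymbol_of_mem_polyT {n : ℕ} {q : DiffFun} (hq : q ∈ polyT n) :
    ∃ F ∈ linChars, HasSymbol n q F := by
  induction hq using Submodule.span_induction with
  | mem _ h =>
    obtain ⟨k, hk, rfl⟩ := h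
    refine ⟨_, mem_linChars k (n - k), ?_⟩
    convert hasSymbol_opK_pow_iterate k (n - k) using 1
    omega
  | zero => exact ⟨0, zero_mem _, fun m _ => map_zero _, map_zero _⟩
  | add _ _ _ _ h₁ h₂ =>
    obtain ⟨F, hF, hF1, hF2⟩ := h₁
    obtain ⟨G, hG, hG1, hG2⟩ := h₂
    refine ⟨F + G, add_mem hF hG, fun m hm => ?_, ?_⟩
    · rw [map_add, hF1 m hm, hG1 m hm, add_zero]
    · rw [map_add, hF2, hG2]
  | smul a _ _ h =>
    obtain ⟨F, hF, hF1, hF2⟩ := h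
    refine ⟨a • F, Submodule.smul_mem _ a hF, fun m hm => ?_, ?_⟩
    · rw [Derivation.map_smul, hF1 m hm, smul_zero]
    · rw [Derivation.map_smul, hF2]

theorem heatFuns_le_ker_heatOp : heatFuns ≤ LinearMap.ker heatOp := inf_le_left

/-- A symmetry of finite order is reduced to order `-∞` by subtracting linear symmetries with the
same coefficient of the highest derivative. -/
theorem ker_heatOp_eq : LinearMap.ker heatOp = linChars ⊔ heatFuns := by
  refine le_antisymm (fun ζ hζ => ?_) (sup_le linChars_le_ker_heatOp heatFuns_le_ker_heatOp)
  obtain ⟨N, hN⟩ := exists_partialU_bound ζ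
  induction N generalizing ζ with
  | zero =>
    refine Submodule.mem_sup_right (mem_heatFuns.2 ⟨hζ, ?_⟩)
    exact partialD_w_eq_zero_of_partialU fun k => hN k (by simp)
  | succ n ih =>
    have hn : ∀ m : ℤ, n < m → partialU m ζ = 0 := fun m hm => hN m (by push_cast; omega)
    obtain ⟨F, hF, hF1, hF2⟩ := exists_hasSymbol_of_mem_polyT (partialU_mem_polyT n hζ hn)
    rw [← sub_add_cancel ζ F]
    refine add_mem (ih _ (sub_mem hζ (linChars_le_ker_heatOp hF)) fun k hk => ?_)
      (Submodule.mem_sup_left hF)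
    rw [map_sub]
    rcases hk.eq_or_lt with rfl | hk
    · rw [hF2, sub_self]
    · rw [hn k hk, hF1 k hk, sub_zero]

theorem evolU_injective : Function.Injective evolU := fun ζ ξ h => by
  rw [← evolU_expW ζ, h, evolU_expW]

/-- Homogeneity in `u` separates the two summands: `∂_w` is the scaling `∑ u_k ∂/∂u_k`, which
acts as the identity on the first and as zero on the second. -/
theorem disjoint_linChars_heatFuns : Disjoint linChars heatFuns := by
  rw [Submodule.disjoint_def]
  intro ζ h1 h2
  rw [← partialD_w_zero_of_mem_linChars h1, (mem_heatFuns.1 h2).2]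

end PotBurgers

end

/-- The algebra of generalized symmetries of `w_t = w_xx + w_x²` is the semidirect sum of the span
of the fields `(G̃^k P̃^l 1) ∂_w` and the ideal of the fields `h(t,x) e^{-w} ∂_w`, `h_t = h_xx`. -/
theorem theorem2 :
    PotBurgers.IsSemidirectSum
      (L := Derivation ℝ PotBurgers.DiffFun PotBurgers.DiffFun)
      PotBurgers.genSym PotBurgers.essSym PotBurgers.trivSym := by
  open PotBurgers in
  rw [genSym_eq, essSym_eq, trivSym_eq]
  refine ⟨?_, ?_, ?_, ?_, ?_⟩
  · rintro _ ⟨ζ, hζ, rfl⟩ _ ⟨ξ, hξ, rfl⟩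
    rw [lie_evolU]
    refine ⟨_, ?_, rfl⟩
    rw [SetLike.mem_coe, LinearMap.mem_ker] at hζ hξ ⊢
    rw [map_sub, ← evolU_heatOp hζ, ← evolU_heatOp hξ, hζ, hξ, map_zero, map_zero, sub_zero]
  · rintro _ ⟨ζ, hζ, rfl⟩ _ ⟨ξ, hξ, rfl⟩
    rw [lie_evolU]
    have hD : ∀ F ∈ linChars, Dx F ∈ linChars := fun _ => Dx_mem_linChars
    have hK : ∀ F ∈ linChars, opK F ∈ linChars := fun _ => opK_mem_linChars
    exact ⟨_, sub_mem (evolU_mem_of_mem_linChars hD hK hζ hξ)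
      (evolU_mem_of_mem_linChars hD hK hξ hζ), rfl⟩
  · rintro _ ⟨ζ, hζ, rfl⟩ _ ⟨ξ, hξ, rfl⟩
    rw [lie_evolU, evolU_eq_zero_of_mem_heatFuns hξ, zero_sub]
    refine ⟨_, neg_mem ?_, rfl⟩
    rw [ker_heatOp_eq] at hζ
    obtain ⟨ζ₁, h₁, ζ₂, h₂, rfl⟩ := Submodule.mem_sup.1 hζ
    rw [map_add, evolU_eq_zero_of_mem_heatFuns h₂, add_zero]
    exact evolU_mem_of_mem_linChars (fun _ => Dx_mem_heatFuns) (fun _ => opK_mem_heatFuns) hξ h₁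
  · rw [ker_heatOp_eq, Submodule.map_sup]
  · exact Submodule.disjoint_map evolU_injective disjoint_linChars_heatFuns
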